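/- \textbf{Setting.} Two agents, $\mathrm{ego}$ and $\mathrm{adv}$, play a stochastic game $\mathcal G$ with finite state space $S$, initial state $s_I$, finite action sets $A_{\mathrm{ego}},A_{\mathrm{adv}}$, transition function $p$, discount factor $\gamma\in(0,1)$ and history-dependent reward functions $R_{\mathrm{ego}},R_{\mathrm{adv}}$. Let $L:S\times A_{\mathrm{ego}}\times A_{\mathrm{adv}}\times S\to 2^{\mathcal P}$ be a labeling function into the subsets of a finite set $\mathcal P$ of propositions. For each agent $j$ let a reward machine with finite state set $V_j$, initial state $v_{I,j}$, transition function $\delta_j:V_j\times 2^{\mathcal P}\to V_j$ and output function $\sigma_j:V_j\times 2^{\mathcal P}\to\mathbb R$ encode $R_j$: along every trajectory of $\mathcal G$ from $s_I$, the reward sequence of agent $j$ is the output sequence of the machine on the sequence of labels. Let $X=S\times V_{\mathrm{ego}}\times V_{\mathrm{adv}}$ and $A=A_{\mathrm{ego}}\times A_{\mathrm{adv}}$. In the product game on $X$ with initial state $x_I=(s_I,v_{I,\mathrm{ego}},v_{I,\mathrm{adv}})$, the action pair $a\in A$ moves $x=(s,v_{\mathrm{ego}},v_{\mathrm{adv}})$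 to $x'=(s',v'_{\mathrm{ego}},v'_{\mathrm{adv}})$ with probability $p'(x,a,x')=p(s,a,s')$ if $v'_j=\delta_j(v_j,L(s,a,s'))$ for both $j$, and with probability $0$ otherwise; the reward of agent $j$ is $R'_j(x,a,x')=\sigma_j(v_j,L(s,a,s'))$. For Markovian strategies $\pi=(\pi_{\mathrm{ego}},\pi_{\mathrm{adv}})$, where $\pi_j$ maps $X$ to probability distributions on $A_j$, let $\tilde v_j(x,\pi)=\sum_{t\ge 0}\gamma^t\,\mathbb E[r_{j,t}\mid\pi,x_0=x]$ in the product game, and $$q^{\pi}_j(x,a)=\sum_{x'}p'(x,a,x')R'_j(x,a,x')+\gamma\sum_{x'}p'(x,a,x')\,\tilde v_j(x',\pi).$$ $\pi$ is a Nash equilibrium if, for every $x\in X$ and each agent $j$, no strategy of agent $j$ used against the other agent's strategy in $\pi$ gives agent $j$ more than $\tilde v_j(x,\pi)$. The functions $q^{\pi}_j$ for such $\pi$ are the Q-functions at the Nash equilibrium $\pi$. For a pair $\sigma$ of mixed actions and $M:A\to\mathbb R$ write $\sigma M=\sum_a\sigma_{\mathrm{ego}}(a_{\mathrm{ego}})\sigma_{\mathrm{adv}}(a_{\mathrm{adv}})M(a)$.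 In a stage game $(M_{\mathrm{ego}},M_{\mathrm{adv}})$, the pair $\sigma$ is a \emph{global optimal point} if $\sigma M_j\ge\sigma'M_j$ for every pair $\sigma'$ and both $j$. It is a \emph{saddle point} if, for both $j$, $\sigma M_j$ is not increased by any change of the mixed action of agent $j$ alone, and not decreased by any change of the mixed action of the other agent alone. \textbf{Learning.} Steps $t=0,1,2,\dots$ count the steps of all episodes consecutively. At step $t$ the current state is $x_t$ (with $x_0=x_I$), an action pair $a_t$ is chosen, and the game moves to $x'_t$, distributed according to $p'(x_t,a_t,\cdot)$ given the past. Then $x_{t+1}=x'_t$, or the game restarts and $x_{t+1}=x_I$. Actions, learning rates $\alpha_t(x,a)$ and restarts are arbitrary, possibly random, but do not depend on the future; in particular $\alpha_t$ and $a_t$ are determined before $x'_t$ is drawn. Each agent $i$ keeps estimates $q^t_{ji}$ of the Q-functions of both agents $j$, with arbitrary initial values, and updates them by $$q^{t+1}_{ji}(x,a)=(1-\alpha_t(x,a))\,q^t_{ji}(x,a)+\alpha_t(x,a)\Bigl(R'_j(x_t,a_t,x'_t)+\gamma\,\sigma^t_i(x'_t)\,q^t_{ji}(x'_t,\cdot)\Bigr),$$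 where $\sigma^t_i(x)$ is a pair of mixed actions computed for the stage game $(q^t_{\mathrm{ego},i}(x,\cdot),q^t_{\mathrm{adv},i}(x,\cdot))$. \textbf{Theorem 1 (convergence of QRM-SG).} Assume: \begin{enumerate} \item With probability 1, every $(x,a)\in X\times A$ is visited infinitely often. \item With probability 1, $0<\alpha_t(x_t,a_t)<1$ for all $t$; $\alpha_t(x,a)=0$ for all $t$ and $(x,a)\ne(x_t,a_t)$; and $\sum_t\alpha_t(x,a)=\infty$ and $\sum_t\alpha_t(x,a)^2<\infty$ for all $(x,a)$. \item One of the following holds: (a) with probability 1, for all $i$, $t$, $x$, the pair $\sigma^t_i(x)$ is a global optimal point of the stage game $(q^t_{\mathrm{ego},i}(x,\cdot),q^t_{\mathrm{adv},i}(x,\cdot))$; or (b) with probability 1, for all $i$, $t$, $x$, it is a saddle point of that stage game. \end{enumerate} Then there is a Nash equilibrium $\pi^*$ of the product game such that, for both learning agents $i$, with probability 1, $(q^t_{\mathrm{ego},i},q^t_{\mathrm{adv},i})$ converges to $(q^{\pi^*}_{\mathrm{ego}},q^{\pi^*}_{\mathrm{adv}})$ as $t\to\infty$. -/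

import Mathlib

open Filter Topology MeasureTheory

/-- The two agents: the ego agent and the adversarial agent. -/
inductive Agent where
  | ego
  | adv
  deriving DecidableEq

instance : Fintype Agent := ⟨{Agent.ego, Agent.adv}, fun j => by cases j <;> simp⟩

/-- The agent other than `j`. -/
def Agent.other : Agent → Agent
  | .ego => .adv
  | .adv => .ego

/-- Joint actions `(a_ego, a_adv)`. -/
abbrev JointAction (A : Agent → Type*) := ∀ j, A j

/-- A two-player general-sum stochastic game with non-Markovian rewards. A history
`(s₀, a₀) … (sₙ, aₙ)` is a function on `Fin (n + 1)`; `reward j n h s'` is the reward of agent `j`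
for the history `h` followed by the state `s'`. -/
structure StochasticGame (S : Type*) (A : Agent → Type*) [Fintype S] where
  init : S
  p : S → JointAction A → S → ℝ
  p_nonneg : ∀ s a s', 0 ≤ p s a s'
  p_sum : ∀ s a, ∑ s', p s a s' = 1
  reward : Agent → (n : ℕ) → (Fin (n + 1) → S × JointAction A) → S → ℝ
  γ : ℝ
  γ_pos : 0 < γ
  γ_le_one : γ ≤ 1

/-- A reward machine: a Mealy machine that reads sets of propositional variables and outputs
real numbers. -/
structure RewardMachine (AP : Type*) (V : Type*) where
  init : V
  δ : V → Set AP → V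
  output : V → Set AP → ℝ

/-- The state of the reward machine after it has read the events `l 0, …, l (n - 1)`. -/
def RewardMachine.run {AP V : Type*} (rm : RewardMachine AP V) (l : ℕ → Set AP) : ℕ → V
  | 0 => rm.init
  | n + 1 => rm.δ (rm.run l n) (l n)

/-- The reward machine `rm` encodes the reward function of agent `j`: along every trajectory, the
reward sequence of agent `j` is the output sequence of `rm` on the event sequence. -/
def RewardMachine.Encodes {S AP V : Type*} {A : Agent → Type*} [Fintype S]
    (rm : RewardMachine AP V) (G : StochasticGame S A) (L : S → JointAction A → S → Set AP)
    (j : Agent) : Prop :=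
  ∀ (s : ℕ → S) (a : ℕ → JointAction A), s 0 = G.init → ∀ n : ℕ,
    G.reward j n (fun k => (s k, a k)) (s (n + 1)) =
      rm.output (rm.run (fun t => L (s t) (a t) (s (t + 1))) n) (L (s n) (a n) (s (n + 1)))

/-- A two-player general-sum stochastic game with Markovian rewards `R j x a x'`. -/
structure MarkovGame (X : Type*) (A : Agent → Type*) [Fintype X] where
  init : X
  p : X → JointAction A → X → ℝ
  p_nonneg : ∀ x a x', 0 ≤ p x a x'
  p_sum : ∀ x a, ∑ x', p x a x' = 1
  R : Agent → X → JointAction A → X → ℝ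
  γ : ℝ

/-- The augmented state space `S × V_ego × V_adv`. -/
abbrev AugState (S : Type*) (V : Agent → Type*) := S × (∀ j, V j)

open Classical in
/-- The stochastic game with reward machines (SGRM): the product of the stochastic game `G` with
the reward machines of both agents, connected by the labeling function `L`. -/
noncomputable def productGame {S AP : Type*} {A V : Agent → Type*} [Fintype S]
    [∀ j, Fintype (V j)] (G : StochasticGame S A) (L : S → JointAction A → S → Set AP)
    (rm : ∀ j, RewardMachine AP (V j)) : MarkovGame (AugState S V) A where
  init := (G.init, fun j => (rm j).init)
  p x a x' := if ∀ j, x'.2 j = (rm j).δ (x.2 j) (L x.1 a x'.1) then G.p x.1 a x'.1 else 0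
  p_nonneg x a x' := by
    split_ifs
    · exact G.p_nonneg _ _ _
    · exact le_rfl
  p_sum x a := by
    rw [Fintype.sum_prod_type]
    refine Eq.trans (Finset.sum_congr rfl fun s' _ => ?_) (G.p_sum x.1 a)
    rw [Finset.sum_eq_single (fun j => (rm j).δ (x.2 j) (L x.1 a s'))]
    · simp
    · intro v _ hv
      refine if_neg fun h => hv (funext h)
    · intro h
      exact absurd (Finset.mem_univ _) h
  R j x a x' := (rm j).output (x.2 j) (L x.1 a x'.1)
  γ := G.γ

section Stage

variable {A : Agent → Type*} [∀ j, Fintype (A j)]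

/-- A pair of mixed strategies for a stage game. -/
abbrev StageProfile (A : Agent → Type*) [∀ j, Fintype (A j)] := ∀ j, stdSimplex ℝ (A j)

/-- The probability of the joint action `a` when the agents randomize independently. -/
def StageProfile.prob (σ : StageProfile A) (a : JointAction A) : ℝ := ∏ j, (σ j).1 (a j)

/-- The expected payoff `σ_ego σ_adv M`. -/
def StageProfile.payoff (σ : StageProfile A) (M : JointAction A → ℝ) : ℝ := ∑ a, σ.prob a * M a

/-- `σ` is a global optimal point of the stage game `(M_ego, M_adv)`: no strategy pair gives any
agent more. -/
def IsGlobalOptimalPoint (M : Agent → JointAction A → ℝ) (σ : StageProfile A) : Prop :=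
  ∀ (j : Agent) (σ' : StageProfile A), σ'.payoff (M j) ≤ σ.payoff (M j)

/-- `σ` is a saddle point of the stage game `(M_ego, M_adv)`: no agent gains by its own deviation,
and no agent loses by a deviation of the other agent. -/
def IsSaddlePoint (M : Agent → JointAction A → ℝ) (σ : StageProfile A) : Prop :=
  ∀ j : Agent,
    (∀ τ : stdSimplex ℝ (A j),
      StageProfile.payoff (Function.update σ j τ) (M j) ≤ σ.payoff (M j)) ∧
    (∀ τ : stdSimplex ℝ (A j.other),
      σ.payoff (M j) ≤ StageProfile.payoff (Function.update σ j.other τ) (M j))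

end Stage

section Equilibrium

variable {X : Type*} {A : Agent → Type*} [Fintype X] [∀ j, Fintype (A j)]

/-- A pair of Markovian strategies. -/
abbrev StrategyProfile (X : Type*) (A : Agent → Type*) [∀ j, Fintype (A j)] :=
  ∀ j, X → stdSimplex ℝ (A j)

/-- The mixed actions that the strategies prescribe in the state `x`. -/
def StrategyProfile.at (π : StrategyProfile X A) (x : X) : StageProfile A := fun j => π j x

open Classical in
/-- The law of the state at time `t` when play starts in `x` and follows `π`. -/
noncomputable def MarkovGame.stateLaw (M : MarkovGame X A) (π : StrategyProfile X A) (x : X) :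
    ℕ → X → ℝ
  | 0 => fun y => if y = x then 1 else 0
  | t + 1 => fun y => ∑ z, M.stateLaw π x t z * (π.at z).payoff (fun a => M.p z a y)

/-- The expected one-step reward `r_j(x, a)`. -/
def MarkovGame.r (M : MarkovGame X A) (j : Agent) (x : X) (a : JointAction A) : ℝ :=
  ∑ x', M.p x a x' * M.R j x a x'

/-- The expected discounted cumulative reward `ṽ_j(x, π) = ∑ₜ γᵗ 𝔼(r_{j,t} | π, x₀ = x)`. -/
noncomputable def MarkovGame.value (M : MarkovGame X A) (j : Agent) (π : StrategyProfile X A)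
    (x : X) : ℝ :=
  ∑' t : ℕ, M.γ ^ t * ∑ z, M.stateLaw π x t z * (π.at z).payoff (M.r j z)

/-- `π` is a Nash equilibrium: from no state does an agent gain by a unilateral change of its
strategy. -/
def MarkovGame.IsNash (M : MarkovGame X A) (π : StrategyProfile X A) : Prop :=
  ∀ (x : X) (j : Agent) (τ : X → stdSimplex ℝ (A j)),
    M.value j (Function.update π j τ) x ≤ M.value j π x

/-- The Q-functions of the two agents at the strategies `π` (used for Nash equilibria `π`): the
expected discounted cumulative reward when `π` is followed from the next period on. -/
noncomputable def MarkovGame.qFun (M : MarkovGame X A) (π : StrategyProfile X A) (j : Agent)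
    (x : X) (a : JointAction A) : ℝ :=
  M.r j x a + M.γ * ∑ x', M.p x a x' * M.value j π x'

/-- A run of the learning algorithm on the probability space `(Ω, μ)`. The time `t` counts the
steps of all episodes consecutively; `ℱ t` is the information available once the actions of step
`t` are chosen. How actions, learning rates and restarts are chosen is left open, except that they
may not look into the future. -/
structure LearningRun (M : MarkovGame X A) {Ω : Type*} [mΩ : MeasurableSpace Ω]
    (μ : Measure Ω) where
  ℱ : Filtration ℕ mΩ
  /-- The current state of step `t`. -/
  state : ℕ → Ω → X
  /-- The joint action of step `t`. -/
  action : ℕ → Ω → JointAction A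
  /-- The state `x'` reached by the transition of step `t`. -/
  succ : ℕ → Ω → X
  /-- The learning rates `α_t(x, a)`. -/
  rate : ℕ → Ω → X → JointAction A → ℝ
  /-- `strat i t ω x` is the strategy pair that learner `i` computes for its stage game at `x`. -/
  strat : Agent → ℕ → Ω → X → StageProfile A
  /-- `q i t ω j` is the Q-function of agent `j` as learned by agent `i` at time `t`. -/
  q : Agent → ℕ → Ω → Agent → X → JointAction A → ℝ
  state_adapted : ∀ t x, MeasurableSet[ℱ t] {ω | state t ω = x}
  action_adapted : ∀ t a, MeasurableSet[ℱ t] {ω | action t ω = a}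
  succ_adapted : ∀ t x, MeasurableSet[ℱ (t + 1)] {ω | succ t ω = x}
  rate_adapted : ∀ t x a, Measurable[ℱ t] fun ω => rate t ω x a
  q_zero_measurable : ∀ i j x a, Measurable[ℱ 0] fun ω => q i 0 ω j x a
  state_zero : ∀ ω, state 0 ω = M.init
  /-- The next step starts in the state reached, or the game restarts. -/
  state_succ : ∀ t ω, state (t + 1) ω = succ t ω ∨ state (t + 1) ω = M.init
  /-- Given the past, the transition follows the transition function of the game. -/
  transition : ∀ t y,
    μ[Set.indicator {ω | succ t ω = y} (fun _ => (1 : ℝ)) | ℱ t]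
      =ᵐ[μ] fun ω => M.p (state t ω) (action t ω) y
  /-- The update of the Q-functions. -/
  update : ∀ i t ω j x a,
    q i (t + 1) ω j x a = (1 - rate t ω x a) * q i t ω j x a +
      rate t ω x a * (M.R j (state t ω) (action t ω) (succ t ω) +
        M.γ * (strat i t ω (succ t ω)).payoff (q i t ω j (succ t ω)))

variable {M : MarkovGame X A} {Ω : Type*} [MeasurableSpace Ω] {μ : Measure Ω}

/-- Almost surely, every state is visited with every joint action infinitely often. -/
def LearningRun.VisitsInfinitelyOften (ρ : LearningRun M μ) : Prop :=
  ∀ᵐ ω ∂μ, ∀ x a, ∃ᶠ t in atTop, ρ.state t ω = x ∧ ρ.action t ω = a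

/-- Almost surely, the learning rates satisfy the Robbins–Monro conditions, and only the visited
entry is updated. -/
def LearningRun.RobbinsMonro (ρ : LearningRun M μ) : Prop :=
  ∀ᵐ ω ∂μ,
    (∀ t, 0 < ρ.rate t ω (ρ.state t ω) (ρ.action t ω) ∧
      ρ.rate t ω (ρ.state t ω) (ρ.action t ω) < 1) ∧
    (∀ x a, Tendsto (fun n => ∑ t ∈ Finset.range n, ρ.rate t ω x a) atTop atTop ∧
      Summable fun t => ρ.rate t ω x a ^ 2) ∧
    (∀ t x a, (x, a) ≠ (ρ.state t ω, ρ.action t ω) → ρ.rate t ω x a = 0)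

/-- Almost surely, every stage game during learning has a global optimal point, and such a point
is used in the updates. -/
def LearningRun.UsesGlobalOptimalPoints (ρ : LearningRun M μ) : Prop :=
  ∀ᵐ ω ∂μ, ∀ i t x, IsGlobalOptimalPoint (fun j => ρ.q i t ω j x) (ρ.strat i t ω x)

/-- Almost surely, every stage game during learning has a saddle point, and such a point is used
in the updates. -/
def LearningRun.UsesSaddlePoints (ρ : LearningRun M μ) : Prop :=
  ∀ᵐ ω ∂μ, ∀ i t x, IsSaddlePoint (fun j => ρ.q i t ω j x) (ρ.strat i t ω x)

end Equilibrium

/-!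
Global optimal points and saddle points share the properties collected in
`IsStableSolutionConcept`: the payoff of agent `j` at a solution is a
nonexpansive function of its own payoff matrix, solutions are Nash equilibria of the stage game, and limits of solutions are solutions. By the nonlinear Hahn–Banach
theorem the payoff at solutions extends to a nonexpansive function `f j` of all payoff matrices
(`IsStableSolutionConcept.exists_value`), so that learning the Q-function of agent `j` is Q-learning
with `f j` in place of the maximum. In particular the Q-functions of the two agents are learned
independently of each other, and the operator `MarkovGame.bellman` of `f j` is a sup-norm contraction
with a unique fixed point `Q j`.

Convergence to `Q j` is `LearningRun.ae_tendsto_of_bellman_eq`. As the learning rates lie in `[0, 1]`,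
the iterates are bounded along every trajectory. The noise of an update is a combination of the
martingale differences `1{x' = y} - p(x, a, y)` with predictable coefficients that are almost surely
square summable, so the accumulated noise converges (`ae_exists_tendsto_sum_mul`, by stopping and
`L²`-bounded martingale convergence). On the almost sure event where this happens the rest is
deterministic: once the tail of the noise is subtracted, each coordinate of the error is averaged,
with weights of infinite sum, with terms of size at most `γ` times the norm of the error, so the
limit superior of that norm is at most `γ` times itself
(`tendsto_zero_of_contracting_averaging`).

For the equilibrium, the strategies computed along one convergent trajectory accumulate by
compactness at solutions of the stage games of `Q`. The Bellman equation then identifies the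
payoffs of these solutions with the values of the resulting Markovian strategies, and since
deviations do not pay in the stage games, they do not pay in the game
(`MarkovGame.isNash_and_qFun_eq`).
-/

/-! ### Deterministic convergence of asynchronous averaging schemes -/

/-- Averaging with weights of infinite sum forgets the initial value, so a bound on the averaged
terms becomes, up to `ε`, a bound on the average. -/
lemma eventually_abs_le_of_averaging {α y b : ℕ → ℝ} {B ε : ℝ} (hB : 0 ≤ B) (hε : 0 < ε)
    (hα0 : ∀ t, 0 ≤ α t) (hα1 : ∀ t, α t ≤ 1)
    (hα : Tendsto (fun n => ∑ t ∈ Finset.range n, α t) atTop atTop)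
    (hy : ∀ t, y (t + 1) = (1 - α t) * y t + α t * b t)
    (hb : ∀ᶠ t in atTop, |b t| ≤ B) : ∀ᶠ t in atTop, |y t| ≤ B + ε := by
  obtain ⟨T, hT⟩ := eventually_atTop.1 hb
  set s : ℕ → ℝ := fun n => ∑ t ∈ Finset.range n, α t with hs
  -- The excess over `B` contracts by the factor `1 - α t ≤ exp (-α t)` at each step.
  have key : ∀ t, T ≤ t → |y t| ≤ B + |y T| * Real.exp (-(s t - s T)) := by
    intro t ht
    induction t, ht using Nat.le_induction with
    | base => simp [hB]
    | succ t ht ih =>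
      have h1 : s (t + 1) = s t + α t := by simp [hs, Finset.sum_range_succ]
      have h2 : Real.exp (-(s (t + 1) - s T)) =
          Real.exp (-α t) * Real.exp (-(s t - s T)) := by
        rw [h1, ← Real.exp_add]; ring_nf
      have h3 : 1 - α t ≤ Real.exp (-α t) := by linarith [Real.add_one_le_exp (-α t)]
      have h4 : 0 ≤ 1 - α t := by linarith [hα1 t]
      have h5 : 0 ≤ |y T| * Real.exp (-(s t - s T)) := by positivity
      calc |y (t + 1)| ≤ (1 - α t) * |y t| + α t * |b t| := by
            rw [hy]
            refine (abs_add_le _ _).trans ?_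
            rw [abs_mul, abs_mul, abs_of_nonneg h4, abs_of_nonneg (hα0 t)]
        _ ≤ (1 - α t) * (B + |y T| * Real.exp (-(s t - s T))) + α t * B :=
            add_le_add (mul_le_mul_of_nonneg_left ih h4)
              (mul_le_mul_of_nonneg_left (hT t ht) (hα0 t))
        _ = B + (1 - α t) * (|y T| * Real.exp (-(s t - s T))) := by ring
        _ ≤ B + Real.exp (-α t) * (|y T| * Real.exp (-(s t - s T))) := by gcongr
        _ = _ := by rw [h2]; ring
  have hlim : Tendsto (fun t => |y T| * Real.exp (-(s t - s T))) atTop (𝓝 0) := by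
    have : Tendsto (fun t => -(s t - s T)) atTop atBot :=
      tendsto_neg_atTop_atBot.comp (tendsto_atTop_add_const_right _ (-s T) hα)
    simpa using (Real.tendsto_exp_atBot.comp this).const_mul |y T|
  filter_upwards [hlim.eventually_lt_const hε, eventually_ge_atTop T] with t h1 h2
  linarith [key t h2]

/-- An asynchronous stochastic approximation scheme whose drift is a sup-norm contraction towards
`0` converges to `0`, as soon as it is bounded and the accumulated noise converges. -/
theorem tendsto_zero_of_contracting_averaging {I : Type*} [Fintype I]
    {α Δ F n : ℕ → I → ℝ} {γ K : ℝ} (hγ0 : 0 ≤ γ) (hγ1 : γ < 1)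
    (hα0 : ∀ t i, 0 ≤ α t i) (hα1 : ∀ t i, α t i ≤ 1)
    (hα : ∀ i, Tendsto (fun n => ∑ t ∈ Finset.range n, α t i) atTop atTop)
    (hΔ : ∀ t i, Δ (t + 1) i = (1 - α t i) * Δ t i + α t i * F t i + n t i)
    (hF : ∀ t i, |F t i| ≤ γ * ‖Δ t‖) (hK : ∀ t, ‖Δ t‖ ≤ K)
    (hn : ∀ i, ∃ l, Tendsto (fun m => ∑ t ∈ Finset.range m, n t i) atTop (𝓝 l)) :
    Tendsto Δ atTop (𝓝 0) := by
  have step : ∀ D ε : ℝ, 0 ≤ D → 0 < ε → (∀ᶠ t in atTop, ‖Δ t‖ ≤ D) →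
      ∀ᶠ t in atTop, ‖Δ t‖ ≤ γ * D + ε := by
    intro D ε hD hε hev
    have : ∀ i, ∀ᶠ t in atTop, |Δ t i| ≤ γ * D + ε := by
      intro i
      obtain ⟨l, hl⟩ := hn i
      -- Subtracting the tail `e t` of the noise leaves an averaging scheme without noise.
      set e : ℕ → ℝ := fun m => ∑ t ∈ Finset.range m, n t i - l with he
      have he0 : Tendsto (fun m => |e m|) atTop (𝓝 0) := by
        simpa [he] using (hl.sub_const l).abs
      have hesucc : ∀ t, e (t + 1) = e t + n t i := fun t => by
        simp [he, Finset.sum_range_succ]; ring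
      have hesmall := he0.eventually_lt_const (show (0 : ℝ) < ε / 3 by positivity)
      have := eventually_abs_le_of_averaging (α := fun t => α t i) (y := fun t => Δ t i - e t)
        (b := fun t => F t i - e t) (B := γ * D + ε / 3) (ε := ε / 3) (by positivity)
        (by positivity) (fun t => hα0 t i) (fun t => hα1 t i) (hα i)
        (fun t => by rw [hΔ, hesucc]; ring) (by
          filter_upwards [hev, hesmall] with t h1 h2
          have h3 := mul_le_mul_of_nonneg_left h1 hγ0
          linarith [abs_sub (F t i) (e t), hF t i])
      filter_upwards [this, hesmall] with t h1 h2
      have h3 := abs_add_le (Δ t i - e t) (e t)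
      rw [sub_add_cancel] at h3
      linarith
    filter_upwards [eventually_all.2 this] with t ht
    exact (pi_norm_le_iff_of_nonneg (by positivity)).2 ht
  have hK0 : 0 ≤ K := (norm_nonneg _).trans (hK 0)
  set γ' := (1 + γ) / 2 with hγ'
  have iter : ∀ k : ℕ, ∀ᶠ t in atTop, ‖Δ t‖ ≤ γ' ^ k * (K + 1) := by
    intro k
    induction k with
    | zero => exact Eventually.of_forall fun t => by simpa using (hK t).trans (by linarith)
    | succ k ih =>
      have hpos : 0 < γ' ^ k * (K + 1) := by positivity
      have h1 : 0 < (1 - γ) / 2 := by linarith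
      filter_upwards [step _ ((1 - γ) / 2 * (γ' ^ k * (K + 1))) hpos.le (by positivity) ih]
        with t ht
      refine ht.trans (le_of_eq ?_)
      rw [pow_succ, hγ']; ring
  rw [tendsto_zero_iff_norm_tendsto_zero]
  refine tendsto_order.2 ⟨fun a ha => Eventually.of_forall fun t => ha.trans_le (norm_nonneg _),
    fun a ha => ?_⟩
  have hlim : Tendsto (fun k : ℕ => γ' ^ k * (K + 1)) atTop (𝓝 0) := by
    simpa using (tendsto_pow_atTop_nhds_zero_of_lt_one (r := γ') (by positivity)
      (by linarith)).mul_const (K + 1)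
  obtain ⟨k, hk⟩ := (hlim.eventually_lt_const ha).exists
  filter_upwards [iter k] with t ht using ht.trans_lt hk

/-! ### Almost sure convergence of martingale transforms -/

section Martingale

variable {Ω : Type*} {mΩ : MeasurableSpace Ω} {μ : Measure Ω} [IsProbabilityMeasure μ]
  {ℱ : Filtration ℕ mΩ}

/-- The transform is a martingale with second moments at most `N`, because its increments are
orthogonal. -/
lemma ae_exists_tendsto_sum_mul_of_sum_sq_le {h d : ℕ → Ω → ℝ} {N : ℝ} (hN : 0 ≤ N)
    (hh : ∀ t, Measurable[ℱ t] (h t)) (hsq : ∀ n ω, ∑ t ∈ Finset.range n, h t ω ^ 2 ≤ N)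
    (hd : ∀ t, Measurable[ℱ (t + 1)] (d t)) (hd1 : ∀ t ω, |d t ω| ≤ 1)
    (hd0 : ∀ t, μ[d t | ℱ t] =ᵐ[μ] 0) :
    ∀ᵐ ω ∂μ, ∃ l, Tendsto (fun n => ∑ t ∈ Finset.range n, h t ω * d t ω) atTop (𝓝 l) := by
  set S : ℕ → Ω → ℝ := fun n ω => ∑ t ∈ Finset.range n, h t ω * d t ω with hS
  have hhb : ∀ t ω, |h t ω| ≤ N + 1 := by
    intro t ω
    have h1 : h t ω ^ 2 ≤ N := (Finset.single_le_sum (f := fun s => h s ω ^ 2)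
      (fun s _ => sq_nonneg _) (Finset.self_mem_range_succ t)).trans (hsq (t + 1) ω)
    nlinarith [sq_abs (h t ω), abs_nonneg (h t ω)]
  have hhdb : ∀ t ω, |h t ω * d t ω| ≤ N + 1 := by
    intro t ω
    rw [abs_mul]
    nlinarith [hhb t ω, hd1 t ω, abs_nonneg (h t ω), abs_nonneg (d t ω)]
  have hSb : ∀ n ω, |S n ω| ≤ n * (N + 1) := by
    intro n ω
    refine (Finset.abs_sum_le_sum_abs _ _).trans ?_
    refine (Finset.sum_le_sum fun t _ => hhdb t ω).trans_eq ?_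
    rw [Finset.sum_const, Finset.card_range, nsmul_eq_mul]
  have hSm : ∀ n, Measurable[ℱ n] (S n) := by
    intro n
    refine Finset.measurable_fun_sum _ fun t ht => ?_
    have ht' := Finset.mem_range.1 ht
    exact ((hh t).mono (ℱ.mono ht'.le) le_rfl).mul ((hd t).mono (ℱ.mono ht') le_rfl)
  have hSm' : ∀ n, Measurable (S n) := fun n => (hSm n).mono (ℱ.le n) le_rfl
  have hhm' : ∀ n, Measurable (h n) := fun n => (hh n).mono (ℱ.le n) le_rfl
  have hdm' : ∀ n, Measurable (d n) := fun n => (hd n).mono (ℱ.le _) le_rfl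
  have hdint : ∀ t, Integrable (d t) μ := fun t =>
    Integrable.of_bound (hdm' t).aestronglyMeasurable 1 (Eventually.of_forall (hd1 t))
  have hSint : ∀ n, Integrable (S n) μ := fun n =>
    Integrable.of_bound (hSm' n).aestronglyMeasurable _ (Eventually.of_forall (hSb n))
  have hcond : ∀ t (f : Ω → ℝ) (C : ℝ), Measurable[ℱ t] f → (∀ ω, |f ω| ≤ C) →
      μ[f * d t | ℱ t] =ᵐ[μ] 0 := by
    intro t f C hf hfb
    have hfi : Integrable (f * d t) μ :=
      (hdint t).bdd_mul (hf.mono (ℱ.le t) le_rfl).aestronglyMeasurable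
        (Eventually.of_forall hfb)
    refine (condExp_mul_of_stronglyMeasurable_left hf.stronglyMeasurable hfi (hdint t)).trans ?_
    filter_upwards [hd0 t] with ω hω
    simp [hω]
  have hmart : Martingale S ℱ μ := by
    refine martingale_of_condExp_sub_eq_zero_nat (fun n => (hSm n).stronglyMeasurable) hSint
      fun t => ?_
    have : S (t + 1) - S t = h t * d t := by
      ext ω; simp [hS, Finset.sum_range_succ]
    rw [this]
    exact hcond t (h t) (N + 1) (hh t) (hhb t)
  have hsqint : ∀ n, Integrable (fun ω => S n ω ^ 2) μ := fun n =>
    Integrable.of_bound ((hSm' n).pow_const 2).aestronglyMeasurable ((n * (N + 1)) ^ 2)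
      (Eventually.of_forall fun ω => by
        rw [Real.norm_eq_abs, abs_pow]
        exact pow_le_pow_left₀ (abs_nonneg _) (hSb n ω) 2)
  have hhsqint : ∀ n, Integrable (fun ω => h n ω ^ 2) μ := fun n =>
    Integrable.of_bound ((hhm' n).pow_const 2).aestronglyMeasurable ((N + 1) ^ 2)
      (Eventually.of_forall fun ω => by
        rw [Real.norm_eq_abs, abs_pow]
        exact pow_le_pow_left₀ (abs_nonneg _) (hhb n ω) 2)
  -- Orthogonality of the increments.
  have hcross : ∀ n, ∫ ω, (S n ω * h n ω) * d n ω ∂μ = 0 := by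
    intro n
    have := hcond n (S n * h n) (n * (N + 1) * (N + 1)) ((hSm n).mul (hh n)) (fun ω => by
      rw [Pi.mul_apply, abs_mul]
      exact mul_le_mul (hSb n ω) (hhb n ω) (abs_nonneg _) (by positivity))
    have h2 := integral_condExp (μ := μ) (f := S n * h n * d n) (ℱ.le n)
    rw [integral_congr_ae this] at h2
    simpa using h2.symm
  have hcrossint : ∀ n, Integrable (fun ω => (S n ω * h n ω) * d n ω) μ := fun n =>
    Integrable.of_bound (((hSm' n).mul (hhm' n)).mul (hdm' n)).aestronglyMeasurable
      (n * (N + 1) * (N + 1)) (Eventually.of_forall fun ω => by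
        rw [mul_assoc, Real.norm_eq_abs, abs_mul]
        exact mul_le_mul (hSb n ω) (hhdb n ω) (abs_nonneg _) (by positivity))
  have hL2 : ∀ n, ∫ ω, S n ω ^ 2 ∂μ ≤ ∫ ω, ∑ t ∈ Finset.range n, h t ω ^ 2 ∂μ := by
    intro n
    induction n with
    | zero => simp [hS]
    | succ n ih =>
      calc ∫ ω, S (n + 1) ω ^ 2 ∂μ
          ≤ ∫ ω, (S n ω ^ 2 + 2 * ((S n ω * h n ω) * d n ω) + h n ω ^ 2) ∂μ := by
            refine integral_mono (hsqint _)
              (((hsqint n).add ((hcrossint n).const_mul 2)).add (hhsqint n)) fun ω => ?_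
            have h1 : S (n + 1) ω = S n ω + h n ω * d n ω := by
              simp [hS, Finset.sum_range_succ]
            have h2 : d n ω ^ 2 ≤ 1 := (sq_le_one_iff_abs_le_one _).2 (hd1 n ω)
            simp only [h1]
            nlinarith [mul_le_mul_of_nonneg_left h2 (sq_nonneg (h n ω))]
        _ = ∫ ω, S n ω ^ 2 ∂μ + ∫ ω, h n ω ^ 2 ∂μ := by
            have hadd : Integrable (fun ω => S n ω ^ 2 + 2 * ((S n ω * h n ω) * d n ω)) μ :=
              (hsqint n).add ((hcrossint n).const_mul 2)
            rw [integral_add hadd (hhsqint n),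
              integral_add (hsqint n) ((hcrossint n).const_mul 2), integral_const_mul, hcross]
            ring
        _ ≤ ∫ ω, ∑ t ∈ Finset.range (n + 1), h t ω ^ 2 ∂μ := by
            simp_rw [Finset.sum_range_succ]
            rw [integral_add (integrable_finsetSum _ fun t _ => hhsqint t) (hhsqint n)]
            linarith
  have hL2' : ∀ n, ∫ ω, S n ω ^ 2 ∂μ ≤ N := by
    intro n
    refine (hL2 n).trans ?_
    refine (integral_mono (integrable_finsetSum _ fun t _ => hhsqint t) (integrable_const N)
      (hsq n)).trans ?_
    simp
  have hL1 : ∀ n, eLpNorm (S n) 1 μ ≤ ((N + 1).toNNReal : ENNReal) := by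
    intro n
    rw [eLpNorm_one_eq_lintegral_enorm, ← ofReal_integral_norm_eq_lintegral_enorm (hSint n)]
    refine ENNReal.ofReal_le_ofReal ?_
    refine (integral_mono (hSint n).norm ((hsqint n).add (integrable_const 1)) fun ω => ?_).trans
      (?_ : ∫ ω, (S n ω ^ 2 + 1) ∂μ ≤ N + 1)
    · simp only [Real.norm_eq_abs, Pi.add_apply]
      nlinarith [sq_abs (S n ω), sq_nonneg (|S n ω| - 1), abs_nonneg (S n ω)]
    · rw [integral_add (hsqint n) (integrable_const 1)]
      simpa using hL2' n
  exact hmart.submartingale.exists_ae_tendsto_of_bdd hL1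

/-- Martingale transforms of bounded martingale differences converge almost surely when the
coefficients are almost surely square summable. No moment of the coefficients is assumed finite:
they are stopped before their sum of squares exceeds a level `N`, which is predictable and leaves
them unchanged on the event that this sum stays below `N`. -/
theorem ae_exists_tendsto_sum_mul {g d : ℕ → Ω → ℝ}
    (hg : ∀ t, Measurable[ℱ t] (g t)) (hsq : ∀ᵐ ω ∂μ, Summable fun t => g t ω ^ 2)
    (hd : ∀ t, Measurable[ℱ (t + 1)] (d t)) (hd1 : ∀ t ω, |d t ω| ≤ 1)
    (hd0 : ∀ t, μ[d t | ℱ t] =ᵐ[μ] 0) :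
    ∀ᵐ ω ∂μ, ∃ l, Tendsto (fun n => ∑ t ∈ Finset.range n, g t ω * d t ω) atTop (𝓝 l) := by
  classical
  set h : ℕ → ℕ → Ω → ℝ := fun N t ω =>
    if ∑ s ∈ Finset.range (t + 1), g s ω ^ 2 ≤ N then g t ω else 0 with hh
  have hmeas : ∀ N t, Measurable[ℱ t] (h N t) := by
    intro N t
    refine Measurable.ite (measurableSet_le ?_ measurable_const) (hg t) measurable_const
    refine Finset.measurable_fun_sum _ fun s hs => Measurable.pow_const ?_ 2
    exact (hg s).mono (ℱ.mono (Nat.lt_succ_iff.1 (Finset.mem_range.1 hs))) le_rfl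
  have hbound : ∀ N n ω, ∑ t ∈ Finset.range n, h N t ω ^ 2 ≤ N := by
    intro N n ω
    induction n with
    | zero => simp
    | succ n ih =>
      by_cases hc : ∑ s ∈ Finset.range (n + 1), g s ω ^ 2 ≤ N
      · refine (Finset.sum_le_sum fun s _ => ?_).trans hc
        simp only [hh]
        split_ifs
        · exact le_rfl
        · simpa using sq_nonneg (g s ω)
      · rw [Finset.sum_range_succ]
        simpa [hh, hc] using ih
  have hall : ∀ᵐ ω ∂μ, ∀ N : ℕ, ∃ l,
      Tendsto (fun n => ∑ t ∈ Finset.range n, h N t ω * d t ω) atTop (𝓝 l) :=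
    ae_all_iff.2 fun N => ae_exists_tendsto_sum_mul_of_sum_sq_le (Nat.cast_nonneg N)
      (hmeas N) (hbound N) hd hd1 hd0
  filter_upwards [hall, hsq] with ω h1 h2
  obtain ⟨N, hN⟩ := exists_nat_ge (∑' t, g t ω ^ 2)
  have : ∀ t, h N t ω = g t ω := fun t =>
    if_pos ((h2.sum_le_tsum _ fun _ _ => sq_nonneg _).trans hN)
  simpa [this] using h1 N

end Martingale

/-! ### Stage games -/

section StageGame

variable {A : Agent → Type*} [∀ j, Fintype (A j)]

lemma StageProfile.prob_nonneg (σ : StageProfile A) (a : JointAction A) : 0 ≤ σ.prob a :=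
  Finset.prod_nonneg fun j _ => (σ j).2.1 (a j)

lemma StageProfile.sum_prob (σ : StageProfile A) : ∑ a, σ.prob a = 1 := by
  have h := Finset.prod_univ_sum (fun j : Agent => (Finset.univ : Finset (A j)))
    (fun j b => (σ j).1 b)
  rw [Fintype.piFinset_univ] at h
  exact h.symm.trans (Finset.prod_eq_one fun j _ => (σ j).2.2)

lemma StageProfile.payoff_mono (σ : StageProfile A) {m m' : JointAction A → ℝ}
    (h : ∀ a, m a ≤ m' a) : σ.payoff m ≤ σ.payoff m' :=
  Finset.sum_le_sum fun a _ => mul_le_mul_of_nonneg_left (h a) (σ.prob_nonneg a)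

lemma StageProfile.payoff_le_add_dist (σ : StageProfile A) (m m' : JointAction A → ℝ) :
    σ.payoff m ≤ σ.payoff m' + dist m m' := by
  calc σ.payoff m ≤ σ.payoff (fun a => m' a + dist m m') := σ.payoff_mono fun a => by
        have := (le_abs_self _).trans (dist_le_pi_dist m m' a)
        linarith
    _ = σ.payoff m' + dist m m' := by
        simp only [StageProfile.payoff, mul_add, Finset.sum_add_distrib, ← Finset.sum_mul,
          σ.sum_prob, one_mul]

lemma continuous_payoff {Z : Type*} [TopologicalSpace Z] {m : Z → JointAction A → ℝ}
    {σ : Z → StageProfile A} (hm : Continuous m) (hσ : Continuous σ) :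
    Continuous fun z => (σ z).payoff (m z) := by
  unfold StageProfile.payoff StageProfile.prob
  exact continuous_finsetSum _ fun a _ => Continuous.mul
    (continuous_finsetProd _ fun j _ => (continuous_apply (a j)).comp
      (continuous_subtype_val.comp ((continuous_apply j).comp hσ)))
    ((continuous_apply a).comp hm)

/-- A solution concept for stage games under which the learning algorithm converges. `Sel m σ` says
that `σ` solves the stage game `m`. -/
structure IsStableSolutionConcept
    (Sel : (Agent → JointAction A → ℝ) → StageProfile A → Prop) : Prop where
  /-- The payoff of a solution is a nonexpansive function of the agent's own payoff matrix; in
  particular it depends on nothing else. -/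
  nonexpansive : ∀ {m m' σ σ'}, Sel m σ → Sel m' σ' → ∀ j,
    σ.payoff (m j) ≤ σ'.payoff (m' j) + dist (m j) (m' j)
  /-- Solutions are Nash equilibria of the stage game. -/
  deviation_le : ∀ {m σ}, Sel m σ → ∀ (j : Agent) (τ : stdSimplex ℝ (A j)),
    StageProfile.payoff (Function.update σ j τ) (m j) ≤ σ.payoff (m j)
  /-- Limits of solutions are solutions of the limit game. -/
  isClosed : IsClosed {z : (Agent → JointAction A → ℝ) × StageProfile A | Sel z.1 z.2}

lemma isStableSolutionConcept_globalOptimal :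
    IsStableSolutionConcept (IsGlobalOptimalPoint (A := A)) where
  nonexpansive {m m' σ σ'} _ h' j :=
    (σ.payoff_le_add_dist (m j) (m' j)).trans (by linarith [h' j σ])
  deviation_le h j τ := h j _
  isClosed := by
    simp only [IsGlobalOptimalPoint, Set.ofPred_forall]
    refine isClosed_iInter fun j => isClosed_iInter fun σ' => isClosed_le
      (continuous_payoff ((continuous_apply j).comp continuous_fst) continuous_const)
      (continuous_payoff ((continuous_apply j).comp continuous_fst) continuous_snd)

lemma update_other_eq_update (σ σ' : StageProfile A) (j : Agent) :
    Function.update σ j.other (σ' j.other) = Function.update σ' j (σ j) := by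
  cases j <;> funext k <;> cases k <;> simp [Agent.other]

lemma isStableSolutionConcept_saddle :
    IsStableSolutionConcept (IsSaddlePoint (A := A)) where
  -- Compare both solutions with the profile in which agent `j` plays as in `σ` and the other agent
  -- plays as in `σ'`.
  nonexpansive {m m' σ σ'} h h' j := by
    have h1 := (h j).2 (σ' j.other)
    have h2 := (h' j).1 (σ j)
    rw [update_other_eq_update] at h1
    have h3 := StageProfile.payoff_le_add_dist (Function.update σ' j (σ j)) (m j) (m' j)
    linarith
  deviation_le h j τ := (h j).1 τ
  isClosed := by
    simp only [IsSaddlePoint, Set.ofPred_forall, Set.ofPred_and]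
    have hc (j : Agent) : Continuous
        fun z : (Agent → JointAction A → ℝ) × StageProfile A => z.1 j :=
      (continuous_apply j).comp continuous_fst
    refine isClosed_iInter fun j => IsClosed.inter (isClosed_iInter fun τ => ?_)
      (isClosed_iInter fun τ => ?_)
    · exact isClosed_le
        (continuous_payoff (hc j) (continuous_snd.update j continuous_const))
        (continuous_payoff (hc j) continuous_snd)
    · exact isClosed_le (continuous_payoff (hc j) continuous_snd)
        (continuous_payoff (hc j) (continuous_snd.update j.other continuous_const))

/-- The payoff of solutions extends to a nonexpansive function of all payoff matrices, including
those of stage games without a solution. -/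
lemma IsStableSolutionConcept.exists_value
    {Sel : (Agent → JointAction A → ℝ) → StageProfile A → Prop}
    (hSel : IsStableSolutionConcept Sel) (j : Agent) :
    ∃ f : (JointAction A → ℝ) → ℝ, LipschitzWith 1 f ∧
      ∀ m σ, Sel m σ → σ.payoff (m j) = f (m j) := by
  classical
  set f₀ : (JointAction A → ℝ) → ℝ := fun w =>
    if h : ∃ z : (Agent → JointAction A → ℝ) × StageProfile A, Sel z.1 z.2 ∧ z.1 j = w
    then h.choose.2.payoff w else 0 with hf₀
  have h0 : ∀ m σ, Sel m σ → f₀ (m j) = σ.payoff (m j) := by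
    intro m σ h
    have hex : ∃ z : (Agent → JointAction A → ℝ) × StageProfile A,
      Sel z.1 z.2 ∧ z.1 j = m j := ⟨(m, σ), h, rfl⟩
    have h1 := hSel.nonexpansive hex.choose_spec.1 h j
    have h2 := hSel.nonexpansive h hex.choose_spec.1 j
    simp only [hex.choose_spec.2, dist_self, add_zero] at h1 h2
    simpa only [hf₀, dif_pos hex] using le_antisymm h1 h2
  have hL : LipschitzOnWith 1 f₀ {w | ∃ m σ, Sel m σ ∧ m j = w} := by
    refine LipschitzOnWith.of_le_add ?_
    rintro _ ⟨m, σ, h, rfl⟩ _ ⟨m', σ', h', rfl⟩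
    rw [h0 m σ h, h0 m' σ' h']
    exact hSel.nonexpansive h h' j
  obtain ⟨f, hf, hfeq⟩ := hL.extend_real
  exact ⟨f, hf, fun m σ h => by rw [← hfeq ⟨m, σ, h, rfl⟩, h0 m σ h]⟩

end StageGame

/-! ### Values of Markovian strategies -/

section Value

variable {X : Type*} {A : Agent → Type*} [Fintype X] [∀ j, Fintype (A j)]

lemma MarkovGame.stateLaw_nonneg (M : MarkovGame X A) (π : StrategyProfile X A) (x : X) (t : ℕ)
    (y : X) : 0 ≤ M.stateLaw π x t y := by
  induction t generalizing y with
  | zero => simp only [stateLaw]; split_ifs <;> norm_num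
  | succ t ih =>
    exact Finset.sum_nonneg fun z _ => mul_nonneg (ih z) (Finset.sum_nonneg fun a _ =>
      mul_nonneg (StageProfile.prob_nonneg _ a) (M.p_nonneg _ _ _))

lemma MarkovGame.sum_stateLaw_succ_mul (M : MarkovGame X A) (π : StrategyProfile X A) (x : X)
    (t : ℕ) (v : X → ℝ) :
    ∑ y, M.stateLaw π x (t + 1) y * v y =
      ∑ z, M.stateLaw π x t z * (π.at z).payoff (fun a => ∑ y, M.p z a y * v y) := by
  simp only [stateLaw, StageProfile.payoff, Finset.sum_mul, Finset.mul_sum]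
  rw [Finset.sum_comm]
  refine Finset.sum_congr rfl fun z _ => ?_
  rw [Finset.sum_comm]
  exact Finset.sum_congr rfl fun a _ => Finset.sum_congr rfl fun y _ => by ring

lemma MarkovGame.sum_stateLaw_zero_mul (M : MarkovGame X A) (π : StrategyProfile X A) (x : X)
    (v : X → ℝ) : ∑ y, M.stateLaw π x 0 y * v y = v x := by
  rw [Finset.sum_eq_single x]
  · simp [stateLaw]
  · intro y _ hy
    simp [stateLaw, hy]
  · exact fun h => absurd (Finset.mem_univ x) h

lemma MarkovGame.sum_stateLaw (M : MarkovGame X A) (π : StrategyProfile X A) (x : X) (t : ℕ) :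
    ∑ y, M.stateLaw π x t y = 1 := by
  induction t with
  | zero => simpa using M.sum_stateLaw_zero_mul π x (fun _ => 1)
  | succ t ih =>
    have h := M.sum_stateLaw_succ_mul π x t (fun _ => 1)
    simp only [mul_one, M.p_sum, StageProfile.payoff, StageProfile.sum_prob] at h
    rw [h, ih]

lemma MarkovGame.abs_sum_stateLaw_mul_le (M : MarkovGame X A) (π : StrategyProfile X A) (x : X)
    (t : ℕ) (v : X → ℝ) : |∑ y, M.stateLaw π x t y * v y| ≤ ‖v‖ := by
  calc |∑ y, M.stateLaw π x t y * v y| ≤ ∑ y, |M.stateLaw π x t y * v y| :=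
        Finset.abs_sum_le_sum_abs _ _
    _ ≤ ∑ y, M.stateLaw π x t y * ‖v‖ := Finset.sum_le_sum fun y _ => by
        rw [abs_mul, abs_of_nonneg (M.stateLaw_nonneg π x t y)]
        exact mul_le_mul_of_nonneg_left (norm_le_pi_norm v y) (M.stateLaw_nonneg π x t y)
    _ = ‖v‖ := by rw [← Finset.sum_mul, M.sum_stateLaw, one_mul]

/-- If `e` is bounded and dominates its own one-step discounted return, then it dominates the
discounted sum of the rewards `b`. -/
lemma tsum_pow_mul_le {γ K : ℝ} (hγ0 : 0 ≤ γ) (hγ1 : γ < 1) {b e : ℕ → ℝ}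
    (hb : Summable fun n => γ ^ n * b n) (he : ∀ n, |e n| ≤ K)
    (h : ∀ n, b n + γ * e (n + 1) ≤ e n) : ∑' n, γ ^ n * b n ≤ e 0 := by
  have hfin : ∀ n, ∑ t ∈ Finset.range n, γ ^ t * b t + γ ^ n * e n ≤ e 0 := by
    intro n
    induction n with
    | zero => simp
    | succ n ih =>
      rw [Finset.sum_range_succ, pow_succ]
      nlinarith [mul_le_mul_of_nonneg_left (h n) (pow_nonneg hγ0 n)]
  have hpow : Tendsto (fun n => γ ^ n * K) atTop (𝓝 0) := by
    simpa using (tendsto_pow_atTop_nhds_zero_of_lt_one hγ0 hγ1).mul_const K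
  have hzero : Tendsto (fun n => γ ^ n * e n) atTop (𝓝 0) :=
    squeeze_zero_norm (fun n => by
      rw [Real.norm_eq_abs, abs_mul, abs_of_nonneg (pow_nonneg hγ0 n)]
      exact mul_le_mul_of_nonneg_left (he n) (pow_nonneg hγ0 n)) hpow
  have hlim := hb.hasSum.tendsto_sum_nat.add hzero
  rw [add_zero] at hlim
  exact le_of_tendsto' hlim hfin

lemma MarkovGame.summable_value (M : MarkovGame X A) (hγ0 : 0 ≤ M.γ) (hγ1 : M.γ < 1)
    (j : Agent) (π : StrategyProfile X A) (x : X) :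
    Summable fun t : ℕ => M.γ ^ t * ∑ z, M.stateLaw π x t z * (π.at z).payoff (M.r j z) := by
  refine Summable.of_norm_bounded
    (g := fun t => M.γ ^ t * ‖fun z => (π.at z).payoff (M.r j z)‖)
    ((summable_geometric_of_lt_one hγ0 hγ1).mul_right _) fun t => ?_
  rw [Real.norm_eq_abs, abs_mul, abs_of_nonneg (pow_nonneg hγ0 t)]
  exact mul_le_mul_of_nonneg_left (M.abs_sum_stateLaw_mul_le π x t _) (pow_nonneg hγ0 t)

lemma MarkovGame.sum_stateLaw_return (M : MarkovGame X A) (j : Agent) (π : StrategyProfile X A)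
    (x : X) (t : ℕ) (v : X → ℝ) :
    ∑ z, M.stateLaw π x t z *
        (π.at z).payoff (fun a => M.r j z a + M.γ * ∑ y, M.p z a y * v y) =
      ∑ z, M.stateLaw π x t z * (π.at z).payoff (M.r j z) +
        M.γ * ∑ z, M.stateLaw π x (t + 1) z * v z := by
  rw [M.sum_stateLaw_succ_mul, Finset.mul_sum, ← Finset.sum_add_distrib]
  refine Finset.sum_congr rfl fun z _ => ?_
  simp only [StageProfile.payoff, mul_add, Finset.sum_add_distrib]
  congr 1
  rw [mul_left_comm]
  congr 1
  rw [Finset.mul_sum]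
  exact Finset.sum_congr rfl fun a _ => by ring

/-- A supersolution of the Bellman equation of `π` dominates the value of `π`. -/
lemma MarkovGame.value_le (M : MarkovGame X A) (hγ0 : 0 ≤ M.γ) (hγ1 : M.γ < 1) {j : Agent}
    {π : StrategyProfile X A} {v : X → ℝ}
    (h : ∀ z, (π.at z).payoff (fun a => M.r j z a + M.γ * ∑ y, M.p z a y * v y) ≤ v z) (x : X) :
    M.value j π x ≤ v x := by
  have := tsum_pow_mul_le hγ0 hγ1 (M.summable_value hγ0 hγ1 j π x)
    (e := fun t => ∑ z, M.stateLaw π x t z * v z)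
    (fun t => M.abs_sum_stateLaw_mul_le π x t v) (fun t => by
      rw [← M.sum_stateLaw_return]
      exact Finset.sum_le_sum fun z _ =>
        mul_le_mul_of_nonneg_left (h z) (M.stateLaw_nonneg π x t z))
  simpa [MarkovGame.value, M.sum_stateLaw_zero_mul] using this

/-- The value of `π` is the only solution of its Bellman equation. -/
lemma MarkovGame.value_eq (M : MarkovGame X A) (hγ0 : 0 ≤ M.γ) (hγ1 : M.γ < 1) {j : Agent}
    {π : StrategyProfile X A} {v : X → ℝ}
    (h : ∀ z, (π.at z).payoff (fun a => M.r j z a + M.γ * ∑ y, M.p z a y * v y) = v z) (x : X) :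
    M.value j π x = v x := by
  refine le_antisymm (M.value_le hγ0 hγ1 (fun z => (h z).le) x) ?_
  have := tsum_pow_mul_le hγ0 hγ1
    (b := fun t => -∑ z, M.stateLaw π x t z * (π.at z).payoff (M.r j z))
    (by simpa using (M.summable_value hγ0 hγ1 j π x).neg)
    (e := fun t => -∑ z, M.stateLaw π x t z * v z)
    (fun t => by rw [abs_neg]; exact M.abs_sum_stateLaw_mul_le π x t v) (fun t => by
      have h1 := M.sum_stateLaw_return j π x t v
      simp only [h] at h1
      linarith)
  simp only [mul_neg, tsum_neg, neg_le_neg_iff] at this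
  simpa [MarkovGame.value, M.sum_stateLaw_zero_mul] using this

end Value

/-! ### The learning process -/

lemma measurable_of_finite_index {Ω X E : Type*} {m : MeasurableSpace Ω} [MeasurableSpace E]
    [Countable X] {s : Ω → X} (hs : ∀ x, MeasurableSet {ω | s ω = x}) {f : X → Ω → E}
    (hf : ∀ x, Measurable (f x)) : Measurable fun ω => f (s ω) ω := by
  intro B hB
  have : (fun ω => f (s ω) ω) ⁻¹' B = ⋃ x, {ω | s ω = x} ∩ f x ⁻¹' B := by
    ext ω; simp
  rw [this]
  exact MeasurableSet.iUnion fun x => (hs x).inter (hf x hB)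

lemma measurable_comp_of_pi {Ω ι : Type*} {m : MeasurableSpace Ω} {f : (ι → ℝ) → ℝ}
    (hf : Measurable f) {w : Ω → ι → ℝ} (hw : ∀ i, Measurable fun ω => w ω i) :
    Measurable fun ω => f (w ω) :=
  hf.comp (measurable_pi_lambda _ hw)

section Learning

variable {X : Type*} {A : Agent → Type*} [Fintype X] [∀ j, Fintype (A j)]
  {M : MarkovGame X A} {Ω : Type*} [mΩ : MeasurableSpace Ω] {μ : Measure Ω}

/-- The target of the learning update averaged over the next state `y`, when the stage game at `y`
is evaluated by `f`. -/
def MarkovGame.bellman (M : MarkovGame X A) (j : Agent) (f : (JointAction A → ℝ) → ℝ)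
    (Q : X → JointAction A → ℝ) : X → JointAction A → ℝ :=
  fun x a => ∑ y, M.p x a y * (M.R j x a y + M.γ * f (Q y))

lemma MarkovGame.abs_bellman_sub_le (M : MarkovGame X A) (hγ0 : 0 ≤ M.γ) {j : Agent}
    {f : (JointAction A → ℝ) → ℝ} (hf : LipschitzWith 1 f) (Q Q' : X → JointAction A → ℝ)
    (x : X) (a : JointAction A) :
    |M.bellman j f Q x a - M.bellman j f Q' x a| ≤ M.γ * dist Q Q' := by
  have h1 : M.bellman j f Q x a - M.bellman j f Q' x a =
      ∑ y, M.p x a y * (M.γ * (f (Q y) - f (Q' y))) := by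
    rw [bellman, bellman, ← Finset.sum_sub_distrib]
    exact Finset.sum_congr rfl fun y _ => by ring
  have h2 : ∀ y, |f (Q y) - f (Q' y)| ≤ dist Q Q' := fun y => by
    have := hf.dist_le_mul (Q y) (Q' y)
    rw [NNReal.coe_one, one_mul, Real.dist_eq] at this
    exact this.trans (dist_le_pi_dist Q Q' y)
  rw [h1]
  calc |∑ y, M.p x a y * (M.γ * (f (Q y) - f (Q' y)))|
      ≤ ∑ y, |M.p x a y * (M.γ * (f (Q y) - f (Q' y)))| := Finset.abs_sum_le_sum_abs _ _
    _ ≤ ∑ y, M.p x a y * (M.γ * dist Q Q') := Finset.sum_le_sum fun y _ => by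
        rw [abs_mul, abs_mul, abs_of_nonneg (M.p_nonneg x a y), abs_of_nonneg hγ0]
        exact mul_le_mul_of_nonneg_left (mul_le_mul_of_nonneg_left (h2 y) hγ0)
          (M.p_nonneg x a y)
    _ = M.γ * dist Q Q' := by rw [← Finset.sum_mul, M.p_sum, one_mul]

lemma MarkovGame.exists_bellman_fixedPoint (M : MarkovGame X A) (hγ0 : 0 ≤ M.γ) (hγ1 : M.γ < 1)
    (j : Agent) {f : (JointAction A → ℝ) → ℝ} (hf : LipschitzWith 1 f) :
    ∃ Q, M.bellman j f Q = Q := by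
  have hc : ContractingWith ⟨M.γ, hγ0⟩ (M.bellman j f) := by
    refine ⟨by exact_mod_cast hγ1, LipschitzWith.of_dist_le_mul fun Q Q' => ?_⟩
    have h0 : 0 ≤ M.γ * dist Q Q' := mul_nonneg hγ0 dist_nonneg
    exact (dist_pi_le_iff h0).2 fun x => (dist_pi_le_iff h0).2 fun a =>
      M.abs_bellman_sub_le hγ0 hf Q Q' x a
  exact ⟨_, hc.fixedPoint_isFixedPt⟩

/-- The Q-function of agent `j` as learned by agent `i` when the stage games are evaluated by the
function `f` instead of the strategies that the learner computes. Unlike `ρ.q`, which need not be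
measurable because the computed strategies need not be, it is adapted as soon as `f` is
measurable. -/
def LearningRun.valueIterate (ρ : LearningRun M μ) (i j : Agent)
    (f : (JointAction A → ℝ) → ℝ) : ℕ → Ω → X → JointAction A → ℝ
  | 0 => fun ω => ρ.q i 0 ω j
  | t + 1 => fun ω x a => (1 - ρ.rate t ω x a) * ρ.valueIterate i j f t ω x a +
      ρ.rate t ω x a * (M.R j (ρ.state t ω) (ρ.action t ω) (ρ.succ t ω) +
        M.γ * f (ρ.valueIterate i j f t ω (ρ.succ t ω)))

lemma LearningRun.q_eq_valueIterate (ρ : LearningRun M μ) {i j : Agent}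
    {f : (JointAction A → ℝ) → ℝ} {ω : Ω}
    (h : ∀ t x, (ρ.strat i t ω x).payoff (ρ.q i t ω j x) = f (ρ.q i t ω j x)) (t : ℕ) :
    ρ.q i t ω j = ρ.valueIterate i j f t ω := by
  induction t with
  | zero => rfl
  | succ t ih =>
    funext x a
    rw [ρ.update, h, ih, valueIterate]

lemma LearningRun.measurable_apply_state_action (ρ : LearningRun M μ) (t : ℕ)
    (g : X → JointAction A → ℝ) : Measurable[ρ.ℱ t] fun ω => g (ρ.state t ω) (ρ.action t ω) :=
  measurable_of_finite_index (ρ.state_adapted t) (f := fun x ω => g x (ρ.action t ω)) fun x =>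
    measurable_of_finite_index (ρ.action_adapted t) (f := fun a _ => g x a) fun _ =>
      measurable_const

lemma LearningRun.measurable_valueIterate (ρ : LearningRun M μ) (i j : Agent)
    {f : (JointAction A → ℝ) → ℝ} (hf : Measurable f) (t : ℕ) (x : X) (a : JointAction A) :
    Measurable[ρ.ℱ t] fun ω => ρ.valueIterate i j f t ω x a := by
  induction t generalizing x a with
  | zero => exact ρ.q_zero_measurable i j x a
  | succ t ih =>
    have hle : ρ.ℱ t ≤ ρ.ℱ (t + 1) := ρ.ℱ.mono t.le_succ
    have hr : Measurable[ρ.ℱ (t + 1)] fun ω => ρ.rate t ω x a :=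
      (ρ.rate_adapted t x a).mono hle le_rfl
    have hi (x : X) (a : JointAction A) :
        Measurable[ρ.ℱ (t + 1)] fun ω => ρ.valueIterate i j f t ω x a :=
      (ih x a).mono hle le_rfl
    have htarget : Measurable[ρ.ℱ (t + 1)] fun ω =>
        M.R j (ρ.state t ω) (ρ.action t ω) (ρ.succ t ω) +
          M.γ * f (ρ.valueIterate i j f t ω (ρ.succ t ω)) := by
      refine measurable_of_finite_index (ρ.succ_adapted t) (f := fun y ω =>
        M.R j (ρ.state t ω) (ρ.action t ω) y + M.γ * f (ρ.valueIterate i j f t ω y)) fun y => ?_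
      exact ((ρ.measurable_apply_state_action t fun x a => M.R j x a y).mono hle le_rfl).add
        ((measurable_comp_of_pi hf fun a => hi y a).const_mul M.γ)
    exact ((measurable_const.sub hr).mul (hi x a)).add (hr.mul htarget)

/-- Since the learning rates lie in `[0, 1]` and `γ < 1`, the iterates are bounded along every
trajectory. -/
lemma LearningRun.exists_abs_valueIterate_le (ρ : LearningRun M μ) (hγ0 : 0 ≤ M.γ)
    (hγ1 : M.γ < 1) (i j : Agent) {f : (JointAction A → ℝ) → ℝ} (hf : LipschitzWith 1 f) {ω : Ω}
    (h0 : ∀ t x a, 0 ≤ ρ.rate t ω x a) (h1 : ∀ t x a, ρ.rate t ω x a ≤ 1) :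
    ∃ K, 0 ≤ K ∧ (∀ t, ‖ρ.valueIterate i j f t ω‖ ≤ K) ∧
      ∀ t x a y, |M.R j x a y + M.γ * f (ρ.valueIterate i j f t ω y)| ≤ K := by
  set R : ℝ := ∑ x, ∑ a, ∑ y, |M.R j x a y| with hR
  have hRle : ∀ x a y, |M.R j x a y| ≤ R := fun x a y =>
    (Finset.single_le_sum (f := fun y => |M.R j x a y|) (fun _ _ => abs_nonneg _)
      (Finset.mem_univ y)).trans <|
    (Finset.single_le_sum (f := fun a => ∑ y, |M.R j x a y|)
      (fun _ _ => Finset.sum_nonneg fun _ _ => abs_nonneg _) (Finset.mem_univ a)).trans <|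
    Finset.single_le_sum (f := fun x => ∑ a, ∑ y, |M.R j x a y|)
      (fun _ _ => Finset.sum_nonneg fun _ _ => Finset.sum_nonneg fun _ _ => abs_nonneg _)
      (Finset.mem_univ x)
  have hR0 : 0 ≤ R := Finset.sum_nonneg fun _ _ => Finset.sum_nonneg fun _ _ =>
    Finset.sum_nonneg fun _ _ => abs_nonneg _
  set C : ℝ := R + M.γ * |f 0| with hC
  have hC0 : 0 ≤ C := by positivity
  have h1γ : 0 < 1 - M.γ := by linarith
  -- `K` satisfies `C + γ K ≤ K`, so that the ball of radius `K` is invariant.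
  set K : ℝ := ‖ρ.q i 0 ω j‖ + C / (1 - M.γ) with hK
  have hK0 : 0 ≤ K := by positivity
  have hCK : C + M.γ * K ≤ K := by
    have h2 : C / (1 - M.γ) * (1 - M.γ) = C := div_mul_cancel₀ _ h1γ.ne'
    nlinarith [norm_nonneg (ρ.q i 0 ω j)]
  have htarget : ∀ w : X → JointAction A → ℝ, ‖w‖ ≤ K → ∀ x a y,
      |M.R j x a y + M.γ * f (w y)| ≤ K := by
    intro w hw x a y
    have h2 := hf.dist_le_mul (w y) 0
    rw [NNReal.coe_one, one_mul, Real.dist_eq, dist_zero_right] at h2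
    have h3 : |f (w y)| ≤ |f 0| + K := by
      have := abs_add_le (f (w y) - f 0) (f 0)
      rw [sub_add_cancel] at this
      linarith [norm_le_pi_norm w y]
    calc |M.R j x a y + M.γ * f (w y)| ≤ |M.R j x a y| + M.γ * |f (w y)| := by
          refine (abs_add_le _ _).trans ?_
          rw [abs_mul, abs_of_nonneg hγ0]
      _ ≤ R + M.γ * (|f 0| + K) := add_le_add (hRle x a y) (mul_le_mul_of_nonneg_left h3 hγ0)
      _ = C + M.γ * K := by rw [hC]; ring
      _ ≤ K := hCK
  have hb : ∀ t, ‖ρ.valueIterate i j f t ω‖ ≤ K := by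
    intro t
    induction t with
    | zero => exact le_add_of_nonneg_right (by positivity)
    | succ t ih =>
      refine (pi_norm_le_iff_of_nonneg hK0).2 fun x => (pi_norm_le_iff_of_nonneg hK0).2 fun a => ?_
      have h2 : |ρ.valueIterate i j f t ω x a| ≤ K :=
        ((norm_le_pi_norm (ρ.valueIterate i j f t ω x) a).trans
          (norm_le_pi_norm (ρ.valueIterate i j f t ω) x)).trans ih
      have h3 := htarget _ ih (ρ.state t ω) (ρ.action t ω) (ρ.succ t ω)
      have h4 : 0 ≤ 1 - ρ.rate t ω x a := by linarith [h1 t x a]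
      rw [valueIterate, Real.norm_eq_abs]
      refine (abs_add_le _ _).trans ?_
      rw [abs_mul, abs_mul, abs_of_nonneg h4, abs_of_nonneg (h0 t x a)]
      nlinarith [mul_le_mul_of_nonneg_left h2 h4, mul_le_mul_of_nonneg_left h3 (h0 t x a)]
  exact ⟨K, hK0, hb, fun t => htarget _ (hb t)⟩

lemma LearningRun.condExp_indicator_sub (ρ : LearningRun M μ) [IsProbabilityMeasure μ] (t : ℕ)
    (y : X) : μ[fun ω => Set.indicator {ω | ρ.succ t ω = y} (fun _ => (1 : ℝ)) ω -
      M.p (ρ.state t ω) (ρ.action t ω) y | ρ.ℱ t] =ᵐ[μ] 0 := by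
  have hset : MeasurableSet {ω | ρ.succ t ω = y} := ρ.ℱ.le _ _ (ρ.succ_adapted t y)
  have hp := ρ.measurable_apply_state_action t fun x a => M.p x a y
  have hple : ∀ x a, |M.p x a y| ≤ 1 := fun x a => by
    rw [abs_of_nonneg (M.p_nonneg x a y), ← M.p_sum x a]
    exact Finset.single_le_sum (fun y _ => M.p_nonneg x a y) (Finset.mem_univ y)
  have hpi : Integrable (fun ω => M.p (ρ.state t ω) (ρ.action t ω) y) μ :=
    Integrable.of_bound (hp.mono (ρ.ℱ.le t) le_rfl).aestronglyMeasurable 1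
      (Eventually.of_forall fun ω => hple _ _)
  have hi : Integrable (Set.indicator {ω | ρ.succ t ω = y} (fun _ => (1 : ℝ))) μ :=
    (integrable_const 1).indicator hset
  refine (condExp_sub hi hpi (ρ.ℱ t)).trans ?_
  rw [condExp_of_stronglyMeasurable (ρ.ℱ.le t) hp.stronglyMeasurable hpi]
  filter_upwards [ρ.transition t y] with ω hω
  rw [Pi.sub_apply, hω, sub_self, Pi.zero_apply]

/-- The learned Q-functions converge almost surely to the fixed point of the Bellman operator of
any nonexpansive function that evaluates the stage games as the learner does. -/
theorem LearningRun.ae_tendsto_of_bellman_eq (ρ : LearningRun M μ) [IsProbabilityMeasure μ]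
    (hγ0 : 0 ≤ M.γ) (hγ1 : M.γ < 1) (hρ : ρ.RobbinsMonro) (i j : Agent)
    {f : (JointAction A → ℝ) → ℝ} (hf : LipschitzWith 1 f)
    (hval : ∀ᵐ ω ∂μ, ∀ t x, (ρ.strat i t ω x).payoff (ρ.q i t ω j x) = f (ρ.q i t ω j x))
    {Q : X → JointAction A → ℝ} (hQ : M.bellman j f Q = Q) :
    ∀ᵐ ω ∂μ, Tendsto (fun t => ρ.q i t ω j) atTop (𝓝 Q) := by
  classical
  set w := ρ.valueIterate i j f with hw
  set d : X → ℕ → Ω → ℝ := fun y t ω =>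
    Set.indicator {ω | ρ.succ t ω = y} (fun _ => (1 : ℝ)) ω -
      M.p (ρ.state t ω) (ρ.action t ω) y with hd
  set c : X → JointAction A → X → ℕ → Ω → ℝ := fun x a y t ω =>
    M.R j x a y + M.γ * f (w t ω y) with hc
  have hrate : ∀ᵐ ω ∂μ, ∀ t x a, 0 ≤ ρ.rate t ω x a ∧ ρ.rate t ω x a ≤ 1 := by
    filter_upwards [hρ] with ω hω t x a
    by_cases h : (x, a) = (ρ.state t ω, ρ.action t ω)
    · obtain ⟨rfl, rfl⟩ := Prod.mk.inj h
      exact ⟨(hω.1 t).1.le, (hω.1 t).2.le⟩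
    · rw [hω.2.2 t x a h]
      exact ⟨le_rfl, zero_le_one⟩
  have hnoise : ∀ᵐ ω ∂μ, ∀ x a y, ∃ l, Tendsto (fun n => ∑ t ∈ Finset.range n,
      ρ.rate t ω x a * c x a y t ω * d y t ω) atTop (𝓝 l) := by
    refine ae_all_iff.2 fun x => ae_all_iff.2 fun a => ae_all_iff.2 fun y => ?_
    refine ae_exists_tendsto_sum_mul (ℱ := ρ.ℱ) (g := fun t ω => ρ.rate t ω x a * c x a y t ω)
      (fun t => ?_) ?_ (fun t => ?_) (fun t ω => ?_) (ρ.condExp_indicator_sub · y)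
    · exact (ρ.rate_adapted t x a).mul (measurable_const.add
        ((measurable_comp_of_pi hf.continuous.measurable fun b =>
          ρ.measurable_valueIterate i j hf.continuous.measurable t y b).const_mul M.γ))
    · filter_upwards [hρ, hrate] with ω hω hr
      obtain ⟨K, hK0, -, hK⟩ := ρ.exists_abs_valueIterate_le hγ0 hγ1 i j hf
        (fun t x a => (hr t x a).1) (fun t x a => (hr t x a).2)
      refine Summable.of_nonneg_of_le (fun t => sq_nonneg _) (fun t => ?_)
        ((hω.2.1 x a).2.mul_right (K ^ 2))
      rw [mul_pow]
      exact mul_le_mul_of_nonneg_left (sq_le_sq' (abs_le.1 (hK t x a y)).1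
        (abs_le.1 (hK t x a y)).2) (sq_nonneg _)
    · exact (measurable_const.indicator (ρ.succ_adapted t y)).sub
        ((ρ.measurable_apply_state_action t fun x a => M.p x a y).mono
          (ρ.ℱ.mono t.le_succ) le_rfl)
    · have hp0 := M.p_nonneg (ρ.state t ω) (ρ.action t ω) y
      have hp1 : M.p (ρ.state t ω) (ρ.action t ω) y ≤ 1 := by
        rw [← M.p_sum (ρ.state t ω) (ρ.action t ω)]
        exact Finset.single_le_sum (fun y _ => M.p_nonneg _ _ y) (Finset.mem_univ y)
      simp only [hd, Set.indicator_apply]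
      rw [abs_le]
      split_ifs <;> constructor <;> linarith
  filter_upwards [hρ, hrate, hnoise, hval] with ω hω hr hn hv
  obtain ⟨K, hK0, hK, -⟩ := ρ.exists_abs_valueIterate_le hγ0 hγ1 i j hf
    (fun t x a => (hr t x a).1) (fun t x a => (hr t x a).2)
  have hdist : ∀ t, dist (w t ω) Q ≤ ‖fun z : X × JointAction A => w t ω z.1 z.2 - Q z.1 z.2‖ :=
    fun t => (dist_pi_le_iff (norm_nonneg _)).2 fun x =>
      (dist_pi_le_iff (norm_nonneg _)).2 fun a => norm_le_pi_norm
        (fun z : X × JointAction A => w t ω z.1 z.2 - Q z.1 z.2) (x, a)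
  have hlim := tendsto_zero_of_contracting_averaging (I := X × JointAction A) hγ0 hγ1
    (α := fun t z => ρ.rate t ω z.1 z.2)
    (Δ := fun t z => w t ω z.1 z.2 - Q z.1 z.2)
    (F := fun t z => M.bellman j f (w t ω) z.1 z.2 - Q z.1 z.2)
    (n := fun t z => ∑ y, ρ.rate t ω z.1 z.2 * c z.1 z.2 y t ω * d y t ω) (K := K + ‖Q‖)
    (fun t z => (hr t _ _).1) (fun t z => (hr t _ _).2) (fun z => (hω.2.1 z.1 z.2).1)
    (fun t z => ?_) (fun t z => ?_) (fun t => ?_) (fun z => ?_)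
  · have h0 : Tendsto (fun t => w t ω) atTop (𝓝 Q) := tendsto_iff_dist_tendsto_zero.2 <|
      squeeze_zero (fun _ => dist_nonneg) hdist (tendsto_zero_iff_norm_tendsto_zero.1 hlim)
    simpa only [ρ.q_eq_valueIterate hv] using h0
  · obtain ⟨x, a⟩ := z
    by_cases h : (x, a) = (ρ.state t ω, ρ.action t ω)
    · obtain ⟨rfl, rfl⟩ := Prod.mk.inj h
      -- The noise is the sampled target minus its mean, the Bellman operator.
      have h1 : ∑ y, ρ.rate t ω (ρ.state t ω) (ρ.action t ω) *
          c (ρ.state t ω) (ρ.action t ω) y t ω * d y t ω =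
          ρ.rate t ω (ρ.state t ω) (ρ.action t ω) *
            (c (ρ.state t ω) (ρ.action t ω) (ρ.succ t ω) t ω -
              M.bellman j f (w t ω) (ρ.state t ω) (ρ.action t ω)) := by
        have h2 : ∑ y, c (ρ.state t ω) (ρ.action t ω) y t ω *
            Set.indicator {ω | ρ.succ t ω = y} (fun _ => (1 : ℝ)) ω =
            c (ρ.state t ω) (ρ.action t ω) (ρ.succ t ω) t ω := by
          simp [Set.indicator_apply]
        rw [← h2, MarkovGame.bellman, ← Finset.sum_sub_distrib, Finset.mul_sum]
        exact Finset.sum_congr rfl fun y _ => by simp only [hd, hc]; ring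
      simp only [h1]
      simp only [hw, LearningRun.valueIterate, hc]
      ring
    · simp only [hw, LearningRun.valueIterate, hω.2.2 t x a h]
      simp
  · have h1 := M.abs_bellman_sub_le hγ0 (j := j) hf (w t ω) Q z.1 z.2
    rw [hQ] at h1
    exact h1.trans (mul_le_mul_of_nonneg_left (hdist t) hγ0)
  · refine (pi_norm_le_iff_of_nonneg (by positivity)).2 fun z => (norm_sub_le _ _).trans ?_
    exact add_le_add
      (((norm_le_pi_norm (w t ω z.1) z.2).trans (norm_le_pi_norm (w t ω) z.1)).trans (hK t))
      ((norm_le_pi_norm (Q z.1) z.2).trans (norm_le_pi_norm Q z.1))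
  · choose l hl using hn z.1 z.2
    refine ⟨∑ y, l y, ?_⟩
    simp_rw [Finset.sum_comm (s := Finset.range _)]
    exact tendsto_finsetSum _ fun y _ => hl y

/-! ### The limit is a Nash equilibrium -/

/-- If every stage game of `Q` is solved by `σ`, and `Q` is the reward plus the discounted payoffs
of these solutions, then `σ` is a Nash equilibrium whose Q-functions are `Q`. -/
lemma MarkovGame.isNash_and_qFun_eq (M : MarkovGame X A) (hγ0 : 0 ≤ M.γ) (hγ1 : M.γ < 1)
    {Sel : (Agent → JointAction A → ℝ) → StageProfile A → Prop}
    (hSel : IsStableSolutionConcept Sel) {Q : Agent → X → JointAction A → ℝ}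
    {σ : X → StageProfile A} (hσ : ∀ x, Sel (fun j => Q j x) (σ x))
    (hQ : ∀ j x a, Q j x a = M.r j x a + M.γ * ∑ y, M.p x a y * (σ y).payoff (Q j y)) :
    M.IsNash (fun j x => σ x j) ∧ M.qFun (fun j x => σ x j) = Q := by
  have hv : ∀ j x, M.value j (fun j x => σ x j) x = (σ x).payoff (Q j x) := fun j x =>
    M.value_eq hγ0 hγ1 (v := fun x => (σ x).payoff (Q j x))
      (fun z => congrArg (σ z).payoff (funext fun a => (hQ j z a).symm)) x
  constructor
  · intro x j τ
    rw [hv]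
    refine M.value_le hγ0 hγ1 (v := fun x => (σ x).payoff (Q j x)) (fun z => ?_) x
    have h1 : StrategyProfile.at (Function.update (fun j x => σ x j) j τ) z =
        Function.update (σ z) j (τ z) := by
      funext k
      by_cases h : k = j
      · subst h; simp [StrategyProfile.at]
      · simp [StrategyProfile.at, h]
    rw [h1, ← funext (hQ j z)]
    exact hSel.deviation_le (hσ z) j (τ z)
  · funext j x a
    simp only [MarkovGame.qFun, hv]
    exact (hQ j x a).symm

/-- The convergence theorem for an arbitrary stable solution concept. The limit does not depend on
the learner, so a single equilibrium serves both. -/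
theorem LearningRun.exists_isNash_and_tendsto (ρ : LearningRun M μ) [IsProbabilityMeasure μ]
    (hγ0 : 0 ≤ M.γ) (hγ1 : M.γ < 1) (hρ : ρ.RobbinsMonro)
    {Sel : (Agent → JointAction A → ℝ) → StageProfile A → Prop}
    (hSel : IsStableSolutionConcept Sel)
    (hstrat : ∀ᵐ ω ∂μ, ∀ i t x, Sel (fun j => ρ.q i t ω j x) (ρ.strat i t ω x)) :
    ∃ π : StrategyProfile X A, M.IsNash π ∧
      ∀ i : Agent, ∀ᵐ ω ∂μ, Tendsto (fun t => ρ.q i t ω) atTop (𝓝 (M.qFun π)) := by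
  choose f hf hfeq using hSel.exists_value
  choose Q hQ using fun j => M.exists_bellman_fixedPoint hγ0 hγ1 j (hf j)
  have hlim : ∀ᵐ ω ∂μ, ∀ i, Tendsto (fun t => ρ.q i t ω) atTop (𝓝 Q) := by
    have : ∀ᵐ ω ∂μ, ∀ i j, Tendsto (fun t => ρ.q i t ω j) atTop (𝓝 (Q j)) := by
      refine ae_all_iff.2 fun i => ae_all_iff.2 fun j =>
        ρ.ae_tendsto_of_bellman_eq hγ0 hγ1 hρ i j (hf j) ?_ (hQ j)
      filter_upwards [hstrat] with ω hω t x
      exact hfeq j _ _ (hω i t x)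
    filter_upwards [this] with ω hω i using tendsto_pi_nhds.2 (hω i)
  -- The strategies computed along one convergent trajectory accumulate at solutions of the stage
  -- games of `Q`.
  obtain ⟨ω, hω, hωs⟩ := (hlim.and hstrat).exists
  set U : Ultrafilter ℕ := Ultrafilter.of atTop
  obtain ⟨σ, -, hσ⟩ := isCompact_univ.ultrafilter_le_nhds
    (U.map fun t => ρ.strat Agent.ego t ω) (by simp)
  have hσ' : Tendsto (fun t => ρ.strat Agent.ego t ω) U (𝓝 σ) := hσ
  have hsel : ∀ x, Sel (fun j => Q j x) (σ x) := fun x => by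
    have hq : Tendsto (fun t j => ρ.q Agent.ego t ω j x) U (𝓝 fun j => Q j x) :=
      tendsto_pi_nhds.2 fun j =>
      tendsto_pi_nhds.1 (tendsto_pi_nhds.1 ((hω Agent.ego).mono_left (Ultrafilter.of_le _)) j) x
    exact hSel.isClosed.mem_of_tendsto (hq.prodMk_nhds (tendsto_pi_nhds.1 hσ' x))
      (Eventually.of_forall fun t => hωs Agent.ego t x)
  have hbell : ∀ j x a,
      Q j x a = M.r j x a + M.γ * ∑ y, M.p x a y * (σ y).payoff (Q j y) := fun j x a => by
    conv_lhs => rw [← hQ j]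
    rw [MarkovGame.bellman, MarkovGame.r, Finset.mul_sum, ← Finset.sum_add_distrib]
    refine Finset.sum_congr rfl fun y _ => ?_
    rw [hfeq j _ _ (hsel y)]
    ring
  obtain ⟨hnash, hqFun⟩ := M.isNash_and_qFun_eq hγ0 hγ1 hSel hsel hbell
  refine ⟨_, hnash, fun i => ?_⟩
  rw [hqFun]
  filter_upwards [hlim] with ω hω using hω i

end Learning

theorem theorem1 {S AP : Type*} {A V : Agent → Type*} [Fintype S] [Finite AP]
    [∀ j, Fintype (A j)] [∀ j, Fintype (V j)]
    (G : StochasticGame S A) (L : S → JointAction A → S → Set AP)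
    (rm : ∀ j, RewardMachine AP (V j)) (hrm : ∀ j, (rm j).Encodes G L j) (hγ : G.γ < 1)
    {Ω : Type*} [MeasurableSpace Ω] (μ : Measure Ω) [IsProbabilityMeasure μ]
    (ρ : LearningRun (productGame G L rm) μ)
    (h1 : ρ.VisitsInfinitelyOften) (h2 : ρ.RobbinsMonro)
    (h3 : ρ.UsesGlobalOptimalPoints ∨ ρ.UsesSaddlePoints) :
    ∃ π : StrategyProfile (AugState S V) A, (productGame G L rm).IsNash π ∧
      ∀ i : Agent, ∀ᵐ ω ∂μ,
        Tendsto (fun t => ρ.q i t ω) atTop (𝓝 ((productGame G L rm).qFun π)) := by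
  rcases h3 with h3 | h3
  · exact ρ.exists_isNash_and_tendsto G.γ_pos.le hγ h2 isStableSolutionConcept_globalOptimal h3
  · exact ρ.exists_isNash_and_tendsto G.γ_pos.le hγ h2 isStableSolutionConcept_saddle h3
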